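/- **Theorem.** Let $D\in\mathbb N=\{1,2,\dots\}$ and let $\Xi$ be a Heisenberg determinantal point process on $\mathbb C^D$, that is, a simple point process on $\mathbb C^D$ (a random, locally finite sum of Dirac masses, almost surely without multiple points) whose $n$-th correlation function with respect to the complex Gaussian measure $\lambda(dx)=\pi^{-D}e^{-|x|^2}\,dx$ is, for every $n\ge 1$, $$\rho_n(x_1,\dots,x_n)=\det_{1\le i,j\le n}\big[e^{x_i\cdot\overline{x_j}}\big],\qquad x\cdot\overline y=\sum_{\ell=1}^D x^{(\ell)}\overline{y^{(\ell)}} .$$ Let $B_R=\{x\in\mathbb C^D:|x|<R\}$. Then $\Xi(B_R)$ has finite second moment for every $R$, and $\Xi$ is in the hyperuniform state of Class I: $\operatorname{Var}[\Xi(B_R)]/\mathbb E[\Xi(B_R)]\to 0$ as $R\to\infty$, and there are constants $c_1,c_2>0$ such that $c_1R^{2D-1}<\operatorname{Var}[\Xi(B_R)]<c_2R^{2D-1}$ for all sufficiently large $R$. More precisely, $$\lim_{R\to\infty}R\,\frac{\operatorname{Var}[\Xi(B_R)]}{\mathbb E[\Xi(B_R)]}=\frac{D}{\sqrt\pi}.$$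 Moreover, the following asymptotic expansion holds as $R\to\infty$: $$\frac{\operatorname{Var}[\Xi(B_R)]}{\mathbb E[\Xi(B_R)]}\sim\frac{D}{\sqrt\pi}\,R^{-1}\sum_{k=0}^\infty(-1)^k\frac{\alpha_k(D)}{(2k+1)\,k!\,2^{4k}}\,R^{-2k},$$ meaning that for every $N\ge 0$ the difference between the left side and the right side with the sum restricted to $0\le k<N$ is $O(R^{-2N-1})$. Here $\alpha_0(D)=1$ and, for $k\ge1$, $$\alpha_k(D)=\prod_{\ell=1}^k\{4D^2-(2\ell-1)^2\}=\prod_{\ell=-k+1}^{k}(2D+2\ell-1).$$ -/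

import Mathlib

open MeasureTheory ProbabilityTheory Filter Topology Asymptotics

/-! ### Point configurations -/

section Configurations

variable {S : Type*} [PseudoMetricSpace S] [MeasurableSpace S]

/-- The configuration space `Conf(S)`: the sums `ξ = ∑ᵢ δ_{xᵢ}` of countably many Dirac masses
(repetitions allowed) that give finite mass to every bounded set. -/
def Conf (S : Type*) [PseudoMetricSpace S] [MeasurableSpace S] : Set (Measure S) :=
  {ξ | (∃ (ι : Type) (_ : Countable ι) (x : ι → S), ξ = Measure.sum fun i => Measure.dirac (x i)) ∧
    ∀ Λ : Set S, Bornology.IsBounded Λ → ξ Λ < ⊤}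

/-- The multiplicity `ξ({x})` of the point `x` in the configuration `ξ`, as a natural number. -/
noncomputable def pointMultiplicity (ξ : Measure S) (x : S) : ℕ := ⌊(ξ {x}).toReal⌋₊

/-- The points of a configuration listed with multiplicity: a canonical index set for the sum
`ξ = ∑ᵢ δ_{xᵢ}`, the point with index `i` being `i.1` (see `Conf.eq_sum_points`). -/
abbrev Points (ξ : Measure S) : Type _ := Σ x : S, Fin (pointMultiplicity ξ x)

/-- The measure `ξₙ = ∑ δ_{(x_{i₁}, …, x_{iₙ})}` on `Sⁿ`, where the sum is over all `n`-tuples of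
pairwise distinct indices `i₁, …, iₙ` of points of the configuration `ξ`. -/
noncomputable def distinctTuples (n : ℕ) (ξ : Measure S) : Measure (Fin n → S) :=
  Measure.sum fun i : Fin n ↪ Points ξ => Measure.dirac fun j => (i j).1

/-- A configuration is the sum of the Dirac masses at its points, listed with multiplicity. -/
theorem Conf.eq_sum_points [MeasurableSingletonClass S] {ξ : Measure S} (h : ξ ∈ Conf S) :
    ξ = Measure.sum fun i : Points ξ => Measure.dirac i.1 := by
  obtain ⟨⟨ι, hι, x, hx⟩, hfin⟩ := h
  have hsing : ∀ s, ξ {s} = ENat.toENNReal (ENat.card {i // x i = s}) := by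
    intro s
    rw [hx, Measure.sum_apply _ (measurableSet_singleton s)]
    have : ∀ i, Measure.dirac (x i) {s} = ({i | x i = s} : Set ι).indicator 1 i := by
      intro i
      rw [Measure.dirac_apply]
      by_cases hi : x i = s <;> simp [hi]
    simp_rw [this]
    rw [← tsum_subtype]
    simp only [Pi.one_apply, ENNReal.tsum_one]
    rfl
  have hmult : ∀ s, Nonempty ({i // x i = s} ≃ Fin (pointMultiplicity ξ s)) := by
    intro s
    have h1 := hfin {s} Bornology.isBounded_singleton
    have hF : Finite {i // x i = s} := by
      rw [hsing] at h1
      by_contra hc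
      rw [not_finite_iff_infinite] at hc
      simp [ENat.card_eq_top_of_infinite] at h1
    refine ⟨Finite.equivFinOfCardEq ?_⟩
    simp only [pointMultiplicity, hsing, ENat.card_eq_coe_natCard]
    simp
  let e : ι ≃ Points ξ := (Equiv.sigmaFiberEquiv x).symm.trans
    (Equiv.sigmaCongrRight fun s => (hmult s).some)
  have he : ∀ i, (e i).1 = x i := fun i => rfl
  ext A hA
  rw [Measure.sum_apply _ hA, ← e.tsum_eq]
  simp only [he]
  conv_lhs => rw [hx, Measure.sum_apply _ hA]

end Configurations

/-! ### Point processes, correlation functions, determinantal point processes -/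

section PointProcesses

variable {Ω S : Type*} [MeasurableSpace Ω] [PseudoMetricSpace S] [MeasurableSpace S]

/-- A point process on `S` over the probability space `(Ω, P)`: a random measure which is
almost surely a configuration. -/
structure IsPointProcess (P : Measure Ω) (Ξ : Ω → Measure S) : Prop where
  measurable : Measurable Ξ
  mem_conf : ∀ᵐ ω ∂P, Ξ ω ∈ Conf S

/-- A point process is simple if almost surely it has no multiple points. -/
def IsSimplePointProcess (P : Measure Ω) (Ξ : Ω → Measure S) : Prop :=
  ∀ᵐ ω ∂P, ∀ x : S, Ξ ω {x} = 0 ∨ Ξ ω {x} = 1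

/-- `ρ` is the `n`-th correlation function of `Ξ` with respect to the reference measure `lam`:
it is symmetric, non-negative and measurable, and `E[⟨Ξₙ, φ⟩] = ∫ φ ρ dlam^{⊗n}` for every bounded
measurable complex function `φ` of compact support on `Sⁿ`. -/
structure IsCorrelationFunction (P : Measure Ω) (Ξ : Ω → Measure S) (lam : Measure S) (n : ℕ)
    (ρ : (Fin n → S) → ℝ) : Prop where
  measurable : Measurable ρ
  nonneg : ∀ x, 0 ≤ ρ x
  symm : ∀ (σ : Equiv.Perm (Fin n)) (x : Fin n → S), ρ (x ∘ σ) = ρ x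
  integrable : ∀ φ : (Fin n → S) → ℂ, Measurable φ → (∃ C : ℝ, ∀ x, ‖φ x‖ ≤ C) →
    HasCompactSupport φ → Integrable (fun ω => ∫ x, φ x ∂(distinctTuples n (Ξ ω))) P
  integral_eq : ∀ φ : (Fin n → S) → ℂ, Measurable φ → (∃ C : ℝ, ∀ x, ‖φ x‖ ≤ C) →
    HasCompactSupport φ →
    ∫ ω, (∫ x, φ x ∂(distinctTuples n (Ξ ω))) ∂P =
      ∫ x, φ x * (ρ x : ℂ) ∂(Measure.pi fun _ : Fin n => lam)

/-- `(Ξ, K, lam)` is a determinantal point process: `Ξ` is a simple point process whose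
`n`-th correlation function with respect to `lam` is `det [K(xᵢ, xⱼ)]` for every `n ≥ 1`. -/
structure IsDPP (P : Measure Ω) (Ξ : Ω → Measure S) (K : S → S → ℂ) (lam : Measure S) : Prop where
  isPointProcess : IsPointProcess P Ξ
  simple : IsSimplePointProcess P Ξ
  measurable_kernel : Measurable (Function.uncurry K)
  correlation : ∀ n : ℕ, 1 ≤ n → ∃ ρ : (Fin n → S) → ℝ, IsCorrelationFunction P Ξ lam n ρ ∧
    ∀ x : Fin n → S, (ρ x : ℂ) = (Matrix.of fun i j => K (x i) (x j)).det

end PointProcesses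

/-! ### The Heisenberg family -/

section Heisenberg

/-- The complex Gaussian reference measure `π^{-D} exp(-|x|²) dx` on `ℂ^D`. -/
noncomputable def gaussianReference (D : ℕ) : Measure (EuclideanSpace ℂ (Fin D)) :=
  volume.withDensity fun x => ENNReal.ofReal (Real.exp (-‖x‖ ^ 2) / Real.pi ^ D)

/-- The correlation kernel `exp(x · ȳ)` on `ℂ^D`. -/
noncomputable def heisenbergKernel (D : ℕ) (x y : EuclideanSpace ℂ (Fin D)) : ℂ :=
  Complex.exp (∑ l, x l * (starRingEnd ℂ) (y l))

/-- `Ξ` is the Heisenberg determinantal point process on `ℂ^D`. -/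
def IsHeisenbergDPP {Ω : Type*} [MeasurableSpace Ω] (P : Measure Ω) (D : ℕ)
    (Ξ : Ω → Measure (EuclideanSpace ℂ (Fin D))) : Prop :=
  IsDPP P Ξ (heisenbergKernel D) (gaussianReference D)

end Heisenberg

/-! ### Number statistics in balls and hyperuniformity -/

section Hyperuniformity

variable {Ω S : Type*} [MeasurableSpace Ω] [SeminormedAddCommGroup S] [MeasurableSpace S]

/-- The random number `Ξ(B_R)` of points in the open ball of radius `R` centred at the origin. -/
noncomputable def ballCount (Ξ : Ω → Measure S) (R : ℝ) (ω : Ω) : ℝ :=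
  (Ξ ω (Metric.ball 0 R)).toReal

/-- The mean `E[Ξ(B_R)]`. -/
noncomputable def ballMean (P : Measure Ω) (Ξ : Ω → Measure S) (R : ℝ) : ℝ :=
  ∫ ω, ballCount Ξ R ω ∂P

/-- The number variance `Var[Ξ(B_R)]`. -/
noncomputable def ballVariance (P : Measure Ω) (Ξ : Ω → Measure S) (R : ℝ) : ℝ :=
  variance (ballCount Ξ R) P

/-- Hyperuniformity of Class I in real dimension `d`, for balls: `Var[Ξ(B_R)] / E[Ξ(B_R)] → 0`,
and `Var[Ξ(B_R)] ≍ R^{d-1}`, as `R → ∞`. -/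
def IsHyperuniformClassI (P : Measure Ω) (Ξ : Ω → Measure S) (d : ℕ) : Prop :=
  Tendsto (fun R => ballVariance P Ξ R / ballMean P Ξ R) atTop (𝓝 0) ∧
  ∃ c₁ c₂ : ℝ, 0 < c₁ ∧ 0 < c₂ ∧ ∀ᶠ R : ℝ in atTop,
    c₁ * R ^ (d - 1) < ballVariance P Ξ R ∧ ballVariance P Ξ R < c₂ * R ^ (d - 1)

end Hyperuniformity

/-- `α_k(D) = ∏_{l=1}^k (4 D² - (2 l - 1)²)`. -/
noncomputable def alphaCoeff (k D : ℕ) : ℝ :=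
  ∏ l ∈ Finset.Icc 1 k, (4 * (D : ℝ) ^ 2 - (2 * (l : ℝ) - 1) ^ 2)

/-! For a determinantal process the variance of the count in $B=B_R$ is the mean minus
$\iint_{B\times B}|K|^2\,d\lambda\,d\lambda$. The Gaussian weights turn $|K(x,y)|^2$ into
$e^{-|x-y|^2}$ and make the mean density the constant $\pi^{-D}$. Since $e^{-|h|^2}$ has mass
$\pi^D$, the variance becomes $\pi^{-2D}\int e^{-|h|^2}\,|B\setminus(B-h)|\,dh$
(`integral_ball_gaussian_escape`): only pairs straddling the sphere contribute, hence surface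
growth.

The volume $|B\setminus(B-h)|$ equals that of the central slab of $B$ of width $|h|$ orthogonal to
$h$ (`volume_ball_diff_translate`), that is, $v_n\int_{-|h|/2}^{|h|/2}(R^2-t^2)_+^{n/2}\,dt$ with
$n=2D-1$ and $v_n$ the volume of the unit $n$-ball. Expanding $(1-s)_+^{n/2}$ at $s=t^2/R^2$ and
integrating term by term leaves odd Gaussian moments, which are Gamma values. The Taylor bound holds
for all $s\ge0$ (`exists_halfPower_remainder_le`), so no tail has to be cut off. A recurrence in $k$
identifies the coefficients with $\alpha_k(D)$ (`choose_mul_Gamma_eq_alphaCoeff`). The limit is the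
case $N=1$ of the expansion, and Class I follows from the limit and the explicit mean $R^{2D}/D!$.
-/

/-! ### Volume of a ball outside its translate -/

section Geometry

/-- The volume of the unit ball in dimension `n`. -/
noncomputable def unitBallVolume (n : ℕ) : ℝ := √Real.pi ^ n / Real.Gamma ((n : ℝ) / 2 + 1)

theorem unitBallVolume_pos (n : ℕ) : 0 < unitBallVolume n := by
  unfold unitBallVolume
  have : 0 < Real.Gamma ((n : ℝ) / 2 + 1) := Real.Gamma_pos_of_pos (by positivity)
  positivity

/-- For $a\le0$ both sides vanish, because `√a = 0` and `n ≠ 0`. Slabs wider than the ball therefore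
need no separate case later. -/
theorem volume_pi_sum_sq_lt {n : ℕ} (hn : n ≠ 0) (a : ℝ) :
    volume {y : Fin n → ℝ | ∑ i, y i ^ 2 < a} =
      ENNReal.ofReal (√a ^ n * unitBallVolume n) := by
  have : Nonempty (Fin n) := ⟨⟨0, Nat.pos_of_ne_zero hn⟩⟩
  have h := EuclideanSpace.volume_ball (Fin n) 0 (√a)
  rw [← (EuclideanSpace.volume_preserving_symm_measurableEquiv_toLp (Fin n)).symm.measure_preimage_equiv]
    at h
  rw [ENNReal.ofReal_mul (by positivity), ENNReal.ofReal_pow (Real.sqrt_nonneg _)]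
  simp only [Fintype.card_fin] at h
  rw [unitBallVolume, ← h]
  congr 1
  ext y
  simp [EuclideanSpace.norm_eq, Real.sqrt_lt_sqrt_iff (Finset.sum_nonneg fun i _ => sq_nonneg (y i))]

theorem volume_euclidean_slab {n : ℕ} (hn : n ≠ 0) (R c : ℝ) (hR : 0 ≤ R) :
    volume {z : EuclideanSpace ℝ (Fin (n + 1)) | ‖z‖ < R ∧ z 0 ∈ Set.Ico (-c) c} =
      ∫⁻ t in Set.Ico (-c) c, ENNReal.ofReal (√(R ^ 2 - t ^ 2) ^ n * unitBallVolume n) := by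
  rw [← (EuclideanSpace.volume_preserving_symm_measurableEquiv_toLp
    (Fin (n + 1))).symm.measure_preimage_equiv,
    ← (volume_preserving_piFinSuccAbove (fun _ : Fin (n + 1) => ℝ) 0).symm.measure_preimage_equiv]
  have hset : ((MeasurableEquiv.piFinSuccAbove (fun _ : Fin (n + 1) => ℝ) 0).symm ⁻¹'
      ((MeasurableEquiv.toLp 2 (Fin (n + 1) → ℝ)).symm.symm ⁻¹'
        {z : EuclideanSpace ℝ (Fin (n + 1)) | ‖z‖ < R ∧ z 0 ∈ Set.Ico (-c) c})) =
      {p : ℝ × (Fin n → ℝ) | ∑ i, p.2 i ^ 2 < R ^ 2 - p.1 ^ 2 ∧ p.1 ∈ Set.Ico (-c) c} := by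
    ext ⟨t, y⟩
    have : 0 ≤ t ^ 2 + ∑ i, y i ^ 2 := by positivity
    simp [EuclideanSpace.norm_eq, Fin.sum_univ_succ, lt_sub_iff_add_lt']
    intro _ _
    rw [Real.sqrt_lt this hR]
  have hmeas : MeasurableSet
      {p : ℝ × (Fin n → ℝ) | ∑ i, p.2 i ^ 2 < R ^ 2 - p.1 ^ 2 ∧ p.1 ∈ Set.Ico (-c) c} := by
    refine MeasurableSet.inter (s₁ := {p : ℝ × (Fin n → ℝ) | ∑ i, p.2 i ^ 2 < R ^ 2 - p.1 ^ 2})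
      (measurableSet_lt (by fun_prop) (by fun_prop)) (measurable_fst measurableSet_Ico)
  rw [hset, Measure.volume_eq_prod, Measure.prod_apply hmeas, ← lintegral_indicator measurableSet_Ico]
  refine lintegral_congr fun t => ?_
  by_cases ht : t ∈ Set.Ico (-c) c
  · rw [Set.indicator_of_mem ht, ← volume_pi_sum_sq_lt hn]
    congr 1
    ext y
    simpa using fun _ => ht
  · rw [Set.indicator_of_notMem ht]
    convert measure_empty (μ := (volume : Measure (Fin n → ℝ)))
    ext y
    simpa using fun _ => by simpa using ht

variable {E : Type*} [NormedAddCommGroup E] [InnerProductSpace ℝ E]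

theorem norm_add_sq_eq_of_unit {u x : E} (hu : ‖u‖ = 1) (r : ℝ) :
    ‖x + r • u‖ ^ 2 = ‖x‖ ^ 2 + 2 * r * (inner ℝ u x + r / 2) := by
  rw [norm_add_sq_real, norm_smul, inner_smul_right, hu, real_inner_comm, Real.norm_eq_abs, mul_one,
    sq_abs]
  ring

variable [FiniteDimensional ℝ E] [MeasurableSpace E] [BorelSpace E]

theorem volume_ball_inter_slab {n : ℕ} (hn : n ≠ 0) (hE : Module.finrank ℝ E = n + 1)
    {u : E} (hu : ‖u‖ = 1) (R c : ℝ) (hR : 0 ≤ R) :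
    volume {x : E | ‖x‖ < R ∧ inner ℝ u x ∈ Set.Ico (-c) c} =
      ∫⁻ t in Set.Ico (-c) c, ENNReal.ofReal (√(R ^ 2 - t ^ 2) ^ n * unitBallVolume n) := by
  have hon : Orthonormal ℝ (({0} : Set (Fin (n + 1))).domRestrict fun _ => u) := by
    refine ⟨fun _ => hu, fun i j hij => (hij (Subsingleton.elim i j)).elim⟩
  obtain ⟨b, hb⟩ := hon.exists_orthonormalBasis_extension_of_card_eq (by simpa using hE)
  have hb0 : b 0 = u := hb 0 rfl
  rw [← volume_euclidean_slab hn R c hR, ← b.measurePreserving_measurableEquiv.measure_preimage_equiv]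
  congr 1
  ext x
  change _ ↔ ‖b.repr x‖ < R ∧ b.repr x 0 ∈ Set.Ico (-c) c
  rw [b.repr.norm_map, b.repr_apply_apply, hb0]
  rfl

/-- With $h=2cu$, one has $\|x+h\|^2-\|x\|^2=4c(\langle u,x\rangle+c)$. Up to volume, both the slab
and $B\setminus(B-h)$ are what remains of $B$ after removing the two caps $\langle u,x\rangle<-c$
and $\langle u,x\rangle\ge c$; the caps have finite volume and cancel. -/
theorem volume_ball_diff_translate {n : ℕ} (hn : n ≠ 0) (hE : Module.finrank ℝ E = n + 1)
    (R : ℝ) (hR : 0 ≤ R) (h : E) :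
    volume {x : E | ‖x‖ < R ∧ R ≤ ‖x + h‖} =
      ∫⁻ t in Set.Ico (-(‖h‖ / 2)) (‖h‖ / 2),
        ENNReal.ofReal (√(R ^ 2 - t ^ 2) ^ n * unitBallVolume n) := by
  rcases eq_or_ne h 0 with rfl | h0
  · have : {x : E | ‖x‖ < R ∧ R ≤ ‖x + 0‖} = ∅ := by
      ext x; simp
    rw [this]; simp
  set c := ‖h‖ / 2 with hc
  have hc0 : 0 < c := by positivity
  obtain ⟨u, hu, hhu⟩ : ∃ u : E, ‖u‖ = 1 ∧ h = (2 * c) • u := by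
    refine ⟨‖h‖⁻¹ • h, by simp [norm_smul, h0], ?_⟩
    rw [hc, mul_div_cancel₀ _ two_ne_zero, smul_inv_smul₀ (by simpa using h0)]
  have hsq : ∀ x : E, ‖x + h‖ ^ 2 = ‖x‖ ^ 2 + 4 * c * (inner ℝ u x + c) := by
    intro x
    rw [hhu, norm_add_sq_eq_of_unit hu]; ring
  have hin : ∀ x : E, inner ℝ u (x + h) = inner ℝ u x + 2 * c := by
    intro x
    rw [hhu, inner_add_right, inner_smul_right, real_inner_self_eq_norm_sq, hu]; ring
  have mB' : MeasurableSet {x : E | ‖x + h‖ < R} := measurableSet_lt (by fun_prop) (by fun_prop)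
  have mlow : MeasurableSet {x : E | inner ℝ u x < -c} := measurableSet_lt (by fun_prop) (by fun_prop)
  have mlow' : MeasurableSet {x : E | inner ℝ u x < c} := measurableSet_lt (by fun_prop) (by fun_prop)
  set vL := volume ({x : E | ‖x‖ < R} ∩ {x | inner ℝ u x < -c}) with hvL
  set vU := volume ({x : E | ‖x‖ < R} \ {x | inner ℝ u x < c}) with hvU
  have hfin : volume {x : E | ‖x‖ < R} < ⊤ := by
    simpa [Metric.ball, dist_zero_right] using measure_ball_lt_top (μ := (volume : Measure E)) (x := 0) (r := R)
  have hL : vL ≠ ⊤ := ((measure_mono Set.inter_subset_left).trans_lt hfin).ne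
  have hU : vU ≠ ⊤ := ((measure_mono Set.sdiff_subset).trans_lt hfin).ne
  have e1 : volume {x : E | ‖x‖ < R} = vL + (volume {x : E | ‖x‖ < R ∧ inner ℝ u x ∈ Set.Ico (-c) c} + vU) := by
    rw [← measure_inter_add_sdiff {x : E | ‖x‖ < R} mlow,
      ← measure_inter_add_sdiff ({x : E | ‖x‖ < R} \ {x | inner ℝ u x < -c}) mlow']
    congr 3
    · ext x
      simp only [Set.mem_inter_iff, Set.mem_sdiff, Set.mem_ofPred_eq, not_lt, Set.mem_Ico]
      tauto
    · ext x
      simp only [Set.mem_sdiff, Set.mem_ofPred_eq, not_lt]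
      constructor
      · rintro ⟨⟨h1, -⟩, h3⟩; exact ⟨h1, h3⟩
      · rintro ⟨h1, h3⟩; exact ⟨⟨h1, by linarith⟩, h3⟩
  -- Below the hyperplane $\langle u,x\rangle=-c$ the shift by $h$ decreases the norm, so the lower
  -- cap lies in $B\cap(B-h)$.
  have l1 : volume (({x : E | ‖x‖ < R} ∩ {x | ‖x + h‖ < R}) ∩ {x | inner ℝ u x < -c}) = vL := by
    rw [hvL]
    congr 1
    ext x
    simp only [Set.mem_inter_iff, Set.mem_ofPred_eq]
    constructor
    · rintro ⟨⟨h1, -⟩, h3⟩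
      exact ⟨h1, h3⟩
    · rintro ⟨h1, h3⟩
      refine ⟨⟨h1, lt_of_le_of_lt ?_ h1⟩, h3⟩
      refine (abs_le_of_sq_le_sq' ?_ (norm_nonneg x)).2
      rw [hsq]
      nlinarith
  -- Shifting by $h$ carries the rest of $B\cap(B-h)$ onto the upper cap.
  have l2 : volume (({x : E | ‖x‖ < R} ∩ {x | ‖x + h‖ < R}) \ {x | inner ℝ u x < -c}) = vU := by
    refine Eq.trans ?_ (measure_preimage_add_right volume h _)
    congr 1
    ext x
    simp only [Set.mem_inter_iff, Set.mem_sdiff, Set.mem_ofPred_eq, not_lt, Set.mem_preimage, hin]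
    constructor
    · rintro ⟨⟨-, h2⟩, h3⟩
      exact ⟨h2, by linarith⟩
    · rintro ⟨h1, h3⟩
      refine ⟨⟨lt_of_le_of_lt ?_ h1, h1⟩, by linarith⟩
      refine (abs_le_of_sq_le_sq' ?_ (norm_nonneg _)).2
      rw [hsq]
      nlinarith
  have e2 : volume {x : E | ‖x‖ < R} =
      vL + (volume {x : E | ‖x‖ < R ∧ R ≤ ‖x + h‖} + vU) := by
    rw [← measure_inter_add_sdiff {x : E | ‖x‖ < R} mB',
      ← measure_inter_add_sdiff ({x : E | ‖x‖ < R} ∩ {x | ‖x + h‖ < R}) mlow, l1, l2, add_assoc,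
      add_comm vU]
    congr 3
    ext x
    simp
  rw [← volume_ball_inter_slab hn hE hu R c hR]
  rw [e1, ENNReal.add_right_inj hL, ENNReal.add_left_inj hU] at e2
  exact e2.symm

theorem volume_real_ball_diff_translate {n : ℕ} (hn : n ≠ 0) (hE : Module.finrank ℝ E = n + 1)
    (R : ℝ) (hR : 0 ≤ R) (h : E) :
    volume.real {x : E | ‖x‖ < R ∧ R ≤ ‖x + h‖} =
      unitBallVolume n * ∫ t in (-(‖h‖ / 2))..(‖h‖ / 2), √(R ^ 2 - t ^ 2) ^ n := by
  rw [Measure.real, volume_ball_diff_translate hn hE R hR h,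
    intervalIntegral.integral_of_le (by linarith [norm_nonneg h]),
    ← integral_Ico_eq_integral_Ioc, ← integral_const_mul, integral_eq_lintegral_of_nonneg_ae]
  · simp_rw [mul_comm]
  · exact Eventually.of_forall fun t => mul_nonneg (unitBallVolume_pos n).le (by positivity)
  · exact (by fun_prop : Continuous fun t : ℝ => unitBallVolume n * √(R ^ 2 - t ^ 2) ^ n).aestronglyMeasurable

end Geometry

/-! ### Taylor expansion of the slab integral, with a global remainder -/

section Taylor

/-- The coefficient of `s ^ k` in the Taylor expansion of `(1 - s) ^ (n / 2)` at `0`. -/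
noncomputable def halfPowerCoeff (n k : ℕ) : ℝ := (-1) ^ k * Ring.choose ((n : ℝ) / 2) k

theorem halfPowerCoeff_isBigO (n N : ℕ) :
    (fun s : ℝ => √(1 - s) ^ n - ∑ k ∈ Finset.range N, halfPowerCoeff n k * s ^ k)
      =O[𝓝 0] fun s => s ^ N := by
  have h := (Real.one_add_rpow_hasFPowerSeriesAt_zero (a := (n : ℝ) / 2)).isBigO_sub_partialSum_pow N
  have hneg : Tendsto (fun s : ℝ => -s) (𝓝 0) (𝓝 0) := by
    simpa using (continuous_neg (G := ℝ)).tendsto 0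
  have h2 := h.comp_tendsto hneg
  refine (h2.congr' ?_ ?_).trans (isBigO_refl _ _).norm_left
  · filter_upwards [eventually_lt_nhds (show (0 : ℝ) < 1 by norm_num)] with s hs
    simp only [Function.comp, zero_add, FormalMultilinearSeries.partialSum, binomialSeries_apply,
      List.ofFn_const, List.prod_replicate, smul_eq_mul]
    congr 1
    · rw [Real.sqrt_eq_rpow, ← Real.rpow_natCast, ← Real.rpow_mul (by linarith)]
      congr 1
      ring
    · refine Finset.sum_congr rfl fun k _ => ?_
      rw [halfPowerCoeff, neg_pow]
      ring
  · filter_upwards with s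
    simp

/-- Near $0$ this is Taylor's bound. For $s\ge r$ the function is at most $1$ and each monomial of
degree below $N$ is at most $(s/r)^N$, so a larger constant absorbs everything. -/
theorem exists_halfPower_remainder_le (n N : ℕ) : ∃ C : ℝ, 0 ≤ C ∧ ∀ s : ℝ, 0 ≤ s →
    |√(1 - s) ^ n - ∑ k ∈ Finset.range N, halfPowerCoeff n k * s ^ k| ≤ C * s ^ N := by
  obtain ⟨C₀, hC₀, hb⟩ := (halfPowerCoeff_isBigO n N).exists_pos
  obtain ⟨δ, hδ, hball⟩ := Metric.eventually_nhds_iff.1 hb.bound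
  set A := 1 + ∑ k ∈ Finset.range N, |halfPowerCoeff n k| with hA
  -- The choice gives $r<\delta$, so the local bound covers $s<r$, and $r\le1$, so that $s\le s/r$.
  set r := min δ 1 / 2 with hr
  have hr0 : 0 < r := by positivity
  have hr1 : r ≤ 1 := by linarith [min_le_right δ 1]
  have hrδ : r < δ := by linarith [min_le_left δ 1, lt_min hδ one_pos]
  have hA0 : 0 ≤ A := by positivity
  refine ⟨max C₀ (A * (r⁻¹) ^ N), le_max_of_le_left hC₀.le, fun s hs => ?_⟩
  rcases lt_or_ge s r with h | h
  · have := hball (y := s) (by rw [Real.dist_0_eq_abs, abs_of_nonneg hs]; linarith)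
    rw [Real.norm_eq_abs, Real.norm_eq_abs, abs_of_nonneg (pow_nonneg hs N)] at this
    exact this.trans (mul_le_mul_of_nonneg_right (le_max_left _ _) (by positivity))
  · have hq : 1 ≤ r⁻¹ * s := by
      rw [inv_mul_eq_div, one_le_div hr0]
      exact h
    have hpow : ∀ k ≤ N, s ^ k ≤ (r⁻¹) ^ N * s ^ N := by
      intro k hk
      calc s ^ k ≤ (r⁻¹ * s) ^ k := by
            refine pow_le_pow_left₀ hs ?_ k
            have := one_le_inv_iff₀.2 ⟨hr0, hr1⟩
            nlinarith
        _ ≤ (r⁻¹ * s) ^ N := pow_le_pow_right₀ hq hk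
        _ = _ := mul_pow _ _ _
    have h1 : |√(1 - s) ^ n| ≤ (r⁻¹) ^ N * s ^ N := by
      rw [abs_of_nonneg (by positivity)]
      refine (pow_le_one₀ (Real.sqrt_nonneg _) ?_).trans (by simpa using hpow 0 (Nat.zero_le _))
      exact Real.sqrt_le_iff.2 ⟨zero_le_one, by linarith⟩
    have h2 : |∑ k ∈ Finset.range N, halfPowerCoeff n k * s ^ k| ≤
        (∑ k ∈ Finset.range N, |halfPowerCoeff n k|) * ((r⁻¹) ^ N * s ^ N) := by
      refine (Finset.abs_sum_le_sum_abs _ _).trans ?_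
      rw [Finset.sum_mul]
      refine Finset.sum_le_sum fun k hk => ?_
      rw [abs_mul, abs_of_nonneg (pow_nonneg hs k)]
      exact mul_le_mul_of_nonneg_left (hpow k (Finset.mem_range.1 hk).le) (abs_nonneg _)
    calc _ ≤ _ := abs_sub _ _
      _ ≤ A * (r⁻¹) ^ N * s ^ N := by rw [hA]; linarith
      _ ≤ _ := mul_le_mul_of_nonneg_right (le_max_right _ _) (by positivity)

theorem exists_integral_sqrt_sub_sq_pow_remainder_le (n N : ℕ) : ∃ C : ℝ, 0 ≤ C ∧
    ∀ R : ℝ, 0 < R → ∀ a : ℝ, 0 ≤ a →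
      |(∫ t in (-a)..a, √(R ^ 2 - t ^ 2) ^ n) -
        ∑ k ∈ Finset.range N, halfPowerCoeff n k * R ^ n * (R⁻¹) ^ (2 * k) *
          (2 * a ^ (2 * k + 1) / (2 * k + 1))| ≤
        C * R ^ n * (R⁻¹) ^ (2 * N) * a ^ (2 * N + 1) := by
  obtain ⟨C, hC, hb⟩ := exists_halfPower_remainder_le n N
  have hpow : ∀ (k : ℕ) (a : ℝ), ∫ t in (-a)..a, t ^ (2 * k) = 2 * a ^ (2 * k + 1) / (2 * k + 1) := by
    intro k a
    rw [integral_pow, Odd.neg_pow ⟨k, rfl⟩]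
    push_cast
    ring
  refine ⟨C * (2 / (2 * N + 1)), by positivity, fun R hR a ha => ?_⟩
  have hpt : ∀ t : ℝ, |√(R ^ 2 - t ^ 2) ^ n -
      ∑ k ∈ Finset.range N, halfPowerCoeff n k * R ^ n * (R⁻¹) ^ (2 * k) * t ^ (2 * k)| ≤
      C * R ^ n * (R⁻¹) ^ (2 * N) * t ^ (2 * N) := by
    intro t
    have h := mul_le_mul_of_nonneg_left (hb ((R⁻¹ * t) ^ 2) (sq_nonneg _)) (pow_nonneg hR.le n)
    have e : √(R ^ 2 - t ^ 2) = R * √(1 - (R⁻¹ * t) ^ 2) := by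
      rw [← Real.sqrt_sq hR.le, ← Real.sqrt_mul (sq_nonneg R), Real.sqrt_sq hR.le]
      congr 1
      field_simp
    have hRn := abs_of_nonneg (pow_nonneg hR.le n)
    rw [← hRn, ← abs_mul, hRn] at h
    rw [e]
    refine le_trans (le_of_eq ?_) (h.trans (le_of_eq ?_))
    · congr 1
      rw [mul_sub, Finset.mul_sum, mul_pow]
      congr 1
      refine Finset.sum_congr rfl fun k _ => ?_
      rw [← pow_mul, mul_pow]
      ring
    · rw [← pow_mul, mul_pow]
      ring
  have hcont : Continuous fun t : ℝ => √(R ^ 2 - t ^ 2) ^ n := by fun_prop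
  have hsum : ∫ t in (-a)..a,
      ∑ k ∈ Finset.range N, halfPowerCoeff n k * R ^ n * (R⁻¹) ^ (2 * k) * t ^ (2 * k) =
      ∑ k ∈ Finset.range N, halfPowerCoeff n k * R ^ n * (R⁻¹) ^ (2 * k) *
          (2 * a ^ (2 * k + 1) / (2 * k + 1)) := by
    rw [intervalIntegral.integral_finsetSum fun k _ => (by fun_prop : Continuous _).intervalIntegrable _ _]
    refine Finset.sum_congr rfl fun k _ => ?_
    rw [intervalIntegral.integral_const_mul, hpow]
  rw [← hsum, ← intervalIntegral.integral_sub (hcont.intervalIntegrable _ _)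
    ((by fun_prop : Continuous _).intervalIntegrable _ _)]
  calc _ ≤ ∫ t in (-a)..a, |√(R ^ 2 - t ^ 2) ^ n -
      ∑ k ∈ Finset.range N, halfPowerCoeff n k * R ^ n * (R⁻¹) ^ (2 * k) * t ^ (2 * k)| :=
        intervalIntegral.abs_integral_le_integral_abs (by linarith)
    _ ≤ ∫ t in (-a)..a, C * R ^ n * (R⁻¹) ^ (2 * N) * t ^ (2 * N) := by
        refine intervalIntegral.integral_mono (by linarith)
          ((by fun_prop : Continuous _).intervalIntegrable _ _)
          ((by fun_prop : Continuous _).intervalIntegrable _ _) hpt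
    _ = _ := by
        rw [intervalIntegral.integral_const_mul, hpow]
        ring

end Taylor

/-! ### Gaussian moments of the norm and the integrated expansion -/

section GaussianMoments

variable {E : Type*} [NormedAddCommGroup E] [InnerProductSpace ℝ E] [FiniteDimensional ℝ E]
  [MeasurableSpace E] [BorelSpace E]

theorem volume_real_ball {D : ℕ} (hD : D ≠ 0) (hE : Module.finrank ℝ E = 2 * D) {R : ℝ}
    (hR : 0 ≤ R) :
    (volume : Measure E).real (Metric.ball 0 R) = R ^ (2 * D) * (Real.pi ^ D / D.factorial) := by
  have : Nontrivial E := Module.nontrivial_of_finrank_pos (R := ℝ) (by omega)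
  rw [Measure.real, InnerProductSpace.volume_ball, hE, ENNReal.toReal_mul, ENNReal.toReal_pow,
    ENNReal.toReal_ofReal hR, pow_mul √Real.pi, Real.sq_sqrt Real.pi_pos.le]
  have : ((2 * D : ℕ) : ℝ) / 2 + 1 = D + 1 := by push_cast; ring
  rw [this, Real.Gamma_nat_eq_factorial, ENNReal.toReal_ofReal (by positivity)]

theorem integrable_exp_neg_norm_sq_mul_norm_pow {D : ℕ} (hD : D ≠ 0)
    (hE : Module.finrank ℝ E = 2 * D) (j : ℕ) :
    Integrable fun h : E => Real.exp (-‖h‖ ^ 2) * ‖h‖ ^ j := by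
  have : Nontrivial E := Module.nontrivial_of_finrank_pos (R := ℝ) (by omega)
  refine (integrable_fun_norm_addHaar (volume : Measure E)
    (f := fun r => Real.exp (-r ^ 2) * r ^ j)).2 ?_
  have h := integrableOn_rpow_mul_exp_neg_rpow (s := ((2 * D - 1 + j : ℕ) : ℝ)) (p := 2)
    (by linarith [Nat.cast_nonneg (α := ℝ) (2 * D - 1 + j)]) (by norm_num)
  refine h.congr_fun (fun r _ => ?_) measurableSet_Ioi
  simp only [hE, smul_eq_mul, Real.rpow_natCast, pow_add]
  norm_num
  ring

theorem integral_exp_neg_norm_sq_mul_norm_pow {D : ℕ} (hD : D ≠ 0)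
    (hE : Module.finrank ℝ E = 2 * D) (j : ℕ) :
    ∫ h : E, Real.exp (-‖h‖ ^ 2) * ‖h‖ ^ j =
      D * (Real.pi ^ D / D.factorial) * Real.Gamma (D + j / 2) := by
  have : Nontrivial E := Module.nontrivial_of_finrank_pos (R := ℝ) (by omega)
  rw [integral_fun_norm_addHaar (volume : Measure E) fun r => Real.exp (-r ^ 2) * r ^ j,
    volume_real_ball hD hE zero_le_one, hE]
  have h := integral_rpow_mul_exp_neg_rpow (q := ((2 * D - 1 + j : ℕ) : ℝ)) (p := 2)
    (by norm_num) (by linarith [Nat.cast_nonneg (α := ℝ) (2 * D - 1 + j)])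
  have e : ∫ r in Set.Ioi (0 : ℝ), r ^ (2 * D - 1) • (Real.exp (-r ^ 2) * r ^ j) =
      ∫ r in Set.Ioi (0 : ℝ), r ^ ((2 * D - 1 + j : ℕ) : ℝ) * Real.exp (-r ^ (2 : ℝ)) := by
    refine setIntegral_congr_fun measurableSet_Ioi fun r _ => ?_
    simp only [smul_eq_mul, Real.rpow_natCast, pow_add]
    norm_num
    ring
  have e2 : (((2 * D - 1 + j : ℕ) : ℝ) + 1) / 2 = D + j / 2 := by
    have : 2 * D - 1 + j + 1 = 2 * D + j := by omega
    have : ((2 * D - 1 + j : ℕ) : ℝ) + 1 = 2 * D + j := by exact_mod_cast this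
    rw [this]
    ring
  rw [e, h, e2]
  simp only [nsmul_eq_mul, smul_eq_mul]
  push_cast
  ring

theorem continuous_integral_sqrt_sub_sq_pow (R : ℝ) (n : ℕ) :
    Continuous fun a : ℝ => ∫ t in (-a)..a, √(R ^ 2 - t ^ 2) ^ n := by
  have hi : ∀ a b : ℝ, IntervalIntegrable (fun t : ℝ => √(R ^ 2 - t ^ 2) ^ n) volume a b :=
    fun a b => (by fun_prop : Continuous _).intervalIntegrable _ _
  have hc := intervalIntegral.continuous_primitive hi 0
  have e : (fun a : ℝ => ∫ t in (-a)..a, √(R ^ 2 - t ^ 2) ^ n) = fun a : ℝ =>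
      (∫ t in (0 : ℝ)..a, √(R ^ 2 - t ^ 2) ^ n) - ∫ t in (0 : ℝ)..(-a), √(R ^ 2 - t ^ 2) ^ n := by
    ext a
    rw [intervalIntegral.integral_interval_sub_left (hi _ _) (hi _ _)]
  rw [e]
  exact hc.sub (hc.comp continuous_neg)

theorem integrable_exp_neg_norm_sq_mul_slab {D : ℕ} (hD : D ≠ 0)
    (hE : Module.finrank ℝ E = 2 * D) (n : ℕ) {R : ℝ} (hR : 0 < R) :
    Integrable fun h : E => Real.exp (-‖h‖ ^ 2) *
      ∫ t in (-(‖h‖ / 2))..(‖h‖ / 2), √(R ^ 2 - t ^ 2) ^ n := by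
  -- With no Taylor terms the remainder estimate bounds the slab integral linearly in $\|h\|$, which
  -- gives an integrable majorant.
  obtain ⟨C, hC, hb⟩ := exists_integral_sqrt_sub_sq_pow_remainder_le n 0
  refine ((integrable_exp_neg_norm_sq_mul_norm_pow hD hE 1).const_mul (C * R ^ n)).mono' ?_ ?_
  · have := (continuous_integral_sqrt_sub_sq_pow R n).comp (by fun_prop : Continuous fun h : E => ‖h‖ / 2)
    exact ((by fun_prop : Continuous fun h : E => Real.exp (-‖h‖ ^ 2)).mul this).aestronglyMeasurable
  · filter_upwards with h
    have := hb R hR (‖h‖ / 2) (by positivity)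
    simp only [Finset.range_zero, Finset.sum_empty, sub_zero, mul_zero, pow_zero, mul_one, zero_add,
      pow_one] at this
    rw [norm_mul, Real.norm_eq_abs, Real.norm_eq_abs, abs_of_pos (Real.exp_pos _)]
    have h2 : |∫ t in (-(‖h‖ / 2))..(‖h‖ / 2), √(R ^ 2 - t ^ 2) ^ n| ≤ C * R ^ n * ‖h‖ := by
      refine this.trans (mul_le_mul_of_nonneg_left (by linarith [norm_nonneg h]) (by positivity))
    calc _ ≤ Real.exp (-‖h‖ ^ 2) * (C * R ^ n * ‖h‖) := by gcongr
      _ = _ := by ring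

theorem exists_integral_exp_mul_slab_remainder_le {D : ℕ} (hD : D ≠ 0)
    (hE : Module.finrank ℝ E = 2 * D) (n N : ℕ) : ∃ C : ℝ, ∀ R : ℝ, 0 < R →
      |(∫ h : E, Real.exp (-‖h‖ ^ 2) *
          ∫ t in (-(‖h‖ / 2))..(‖h‖ / 2), √(R ^ 2 - t ^ 2) ^ n) -
        ∑ k ∈ Finset.range N, halfPowerCoeff n k * R ^ n * (R⁻¹) ^ (2 * k) *
          (D * (Real.pi ^ D / D.factorial) * Real.Gamma (D + k + 1 / 2) /
            ((2 * k + 1) * 2 ^ (2 * k)))| ≤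
        C * (R ^ n * (R⁻¹) ^ (2 * N)) := by
  obtain ⟨C, hC, hb⟩ := exists_integral_sqrt_sub_sq_pow_remainder_le n N
  refine ⟨C * (1 / 2) ^ (2 * N + 1) * ∫ h : E, Real.exp (-‖h‖ ^ 2) * ‖h‖ ^ (2 * N + 1),
    fun R hR => ?_⟩
  have hI := integrable_exp_neg_norm_sq_mul_slab hD hE n hR (E := E)
  have hM := integrable_exp_neg_norm_sq_mul_norm_pow hD hE (E := E)
  -- The interval endpoint is $\|h\|/2$; the factor $2(1/2)^{2k+1}=2^{-2k}$ is separated from the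
  -- moment of order $2k+1$.
  set c : ℕ → ℝ := fun k => halfPowerCoeff n k * R ^ n * (R⁻¹) ^ (2 * k) *
    (2 * (1 / 2) ^ (2 * k + 1) / (2 * k + 1)) with hc
  have hsum : ∑ k ∈ Finset.range N, halfPowerCoeff n k * R ^ n * (R⁻¹) ^ (2 * k) *
          (D * (Real.pi ^ D / D.factorial) * Real.Gamma (D + k + 1 / 2) /
            ((2 * k + 1) * 2 ^ (2 * k))) =
      ∫ h : E, ∑ k ∈ Finset.range N, c k * (Real.exp (-‖h‖ ^ 2) * ‖h‖ ^ (2 * k + 1)) := by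
    rw [integral_finsetSum _ fun k _ => (hM _).const_mul _]
    refine Finset.sum_congr rfl fun k _ => ?_
    rw [integral_const_mul, integral_exp_neg_norm_sq_mul_norm_pow hD hE]
    have : (D : ℝ) + ((2 * k + 1 : ℕ) : ℝ) / 2 = D + k + 1 / 2 := by push_cast; ring
    rw [this, hc]
    simp only [one_div, inv_pow, pow_succ]
    field_simp
  rw [hsum, ← integral_sub hI (integrable_finsetSum _ fun k _ => (hM _).const_mul _)]
  have hbd : ∀ h : E, |Real.exp (-‖h‖ ^ 2) *
          (∫ t in (-(‖h‖ / 2))..(‖h‖ / 2), √(R ^ 2 - t ^ 2) ^ n) -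
        ∑ k ∈ Finset.range N, c k * (Real.exp (-‖h‖ ^ 2) * ‖h‖ ^ (2 * k + 1))| ≤
      C * (1 / 2) ^ (2 * N + 1) * (R ^ n * (R⁻¹) ^ (2 * N)) *
        (Real.exp (-‖h‖ ^ 2) * ‖h‖ ^ (2 * N + 1)) := by
    intro h
    have h1 := mul_le_mul_of_nonneg_left (hb R hR (‖h‖ / 2) (by positivity))
      (Real.exp_pos (-‖h‖ ^ 2)).le
    have he := abs_of_pos (Real.exp_pos (-‖h‖ ^ 2))
    rw [← he, ← abs_mul, he] at h1
    refine le_trans (le_of_eq ?_) (h1.trans (le_of_eq ?_))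
    · congr 1
      rw [mul_sub, Finset.mul_sum]
      congr 1
      refine Finset.sum_congr rfl fun k _ => ?_
      rw [hc, div_eq_mul_one_div ‖h‖, mul_pow]
      ring
    · rw [div_eq_mul_one_div ‖h‖, mul_pow]
      ring
  refine (abs_integral_le_integral_abs).trans ((integral_mono_of_nonneg
    (Eventually.of_forall fun h => abs_nonneg _) ((hM _).const_mul _)
    (Eventually.of_forall hbd)).trans (le_of_eq ?_))
  rw [integral_const_mul]
  ring

end GaussianMoments

/-! ### Gaussian pair integral as an escape volume -/

section GaussianConvolution

variable {E : Type*} [NormedAddCommGroup E] [InnerProductSpace ℝ E] [FiniteDimensional ℝ E]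
  [MeasurableSpace E] [BorelSpace E]

theorem integral_exp_neg_norm_sq {D : ℕ} (hE : Module.finrank ℝ E = 2 * D) :
    ∫ h : E, Real.exp (-‖h‖ ^ 2) = Real.pi ^ D := by
  have h := GaussianFourier.integral_rexp_neg_mul_sq_norm (V := E) one_pos
  rw [hE] at h
  simp only [neg_mul, one_mul, div_one] at h
  rw [h, ← Real.rpow_natCast]
  congr 1
  push_cast
  ring

/-- For fixed $x$, the mass missing from $\int_B e^{-|x-y|^2}dy$ is carried by the displacements
$h=y-x$ that leave $B$; Fubini then integrates over $x$ first. -/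
theorem integral_ball_gaussian_escape {D : ℕ} (hD : D ≠ 0) (hE : Module.finrank ℝ E = 2 * D) (R : ℝ) :
    (volume : Measure E).real (Metric.ball 0 R) * Real.pi ^ D -
      ∫ x in Metric.ball (0 : E) R, ∫ y in Metric.ball (0 : E) R, Real.exp (-‖x - y‖ ^ 2) =
    ∫ h : E, Real.exp (-‖h‖ ^ 2) * volume.real {x : E | ‖x‖ < R ∧ R ≤ ‖x + h‖} := by
  set B := Metric.ball (0 : E) R with hB
  have hBm : MeasurableSet B := measurableSet_ball
  have hg : Integrable fun h : E => Real.exp (-‖h‖ ^ 2) := by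
    simpa using integrable_exp_neg_norm_sq_mul_norm_pow hD hE 0
  have hgx : ∀ x : E, Integrable fun y : E => Real.exp (-‖x - y‖ ^ 2) := fun x =>
    hg.comp_sub_left x
  have hfin : volume B ≠ ⊤ := measure_ball_lt_top.ne
  have hinner : ∀ x : E, ∫ y in B, Real.exp (-‖x - y‖ ^ 2) =
      Real.pi ^ D - ∫ h, {h : E | R ≤ ‖x + h‖}.indicator (fun h => Real.exp (-‖h‖ ^ 2)) h := by
    intro x
    have h1 : ∫ y, Real.exp (-‖x - y‖ ^ 2) = Real.pi ^ D := by
      rw [integral_sub_left_eq_self (fun y : E => Real.exp (-‖y‖ ^ 2)) volume x,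
        integral_exp_neg_norm_sq hE]
    have h2 : ∫ h, {h : E | R ≤ ‖x + h‖}.indicator (fun h => Real.exp (-‖h‖ ^ 2)) h =
        ∫ y in Bᶜ, Real.exp (-‖x - y‖ ^ 2) := by
      rw [← integral_indicator hBm.compl,
        ← integral_add_left_eq_self (Bᶜ.indicator fun y => Real.exp (-‖x - y‖ ^ 2)) x]
      refine integral_congr_ae (Eventually.of_forall fun h => ?_)
      beta_reduce
      by_cases hh : R ≤ ‖x + h‖
      · have : x + h ∈ Bᶜ := by simpa [hB] using hh
        rw [Set.indicator_of_mem this, Set.indicator_of_mem (by exact hh)]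
        simp
      · have : x + h ∉ Bᶜ := by simpa [hB] using hh
        rw [Set.indicator_of_notMem this, Set.indicator_of_notMem (by exact hh)]
    rw [h2, ← h1, ← integral_add_compl hBm (hgx x)]
    ring
  set F : E → E → ℝ := fun x h => {h : E | R ≤ ‖x + h‖}.indicator (fun h => Real.exp (-‖h‖ ^ 2)) h
    with hF
  have hFint : Integrable (Function.uncurry F) ((volume.restrict B).prod volume) := by
    have hdom : Integrable (fun p : E × E => (1 : ℝ) * Real.exp (-‖p.2‖ ^ 2))
        ((volume.restrict B).prod volume) := by
      have : IsFiniteMeasure (volume.restrict B) := ⟨by simpa using hfin.lt_top⟩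
      exact (integrable_const (1 : ℝ)).mul_prod hg
    have e : Function.uncurry F =
        {p : E × E | R ≤ ‖p.1 + p.2‖}.indicator fun p => (1 : ℝ) * Real.exp (-‖p.2‖ ^ 2) := by
      ext ⟨x, h⟩
      simp [hF, Set.indicator]
    rw [e]
    exact hdom.indicator (measurableSet_le (by fun_prop) (by fun_prop))
  have hswap := integral_integral_swap hFint
  have hFi : Integrable (fun x => ∫ h, F x h) (volume.restrict B) := hFint.integral_prod_left
  have hc : IntegrableOn (fun _ : E => Real.pi ^ D) B := integrableOn_const hfin
  simp_rw [hinner]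
  rw [integral_sub hc hFi, setIntegral_const, smul_eq_mul, sub_sub_cancel, hswap]
  refine integral_congr_ae (Eventually.of_forall fun h => ?_)
  have hm : MeasurableSet {x : E | R ≤ ‖x + h‖} := measurableSet_le (by fun_prop) (by fun_prop)
  have e : (fun x => F x h) = {x : E | R ≤ ‖x + h‖}.indicator fun _ => Real.exp (-‖h‖ ^ 2) := by
    ext x
    simp [hF, Set.indicator]
  have hset : {x : E | R ≤ ‖x + h‖} ∩ B = {x : E | ‖x‖ < R ∧ R ≤ ‖x + h‖} := by
    ext x
    simp [hB, and_comm]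
  simp only [e]
  rw [integral_indicator_const _ hm, measureReal_restrict_apply hm, hset, smul_eq_mul, mul_comm]

end GaussianConvolution

/-! ### Counting tuples of distinct points -/

section Counting

theorem sum_dirac_apply {ι X : Type*} [MeasurableSpace X] (x : ι → X) {A : Set X}
    (hA : MeasurableSet A) :
    (Measure.sum fun i => Measure.dirac (x i)) A = ENat.toENNReal (ENat.card {i // x i ∈ A}) := by
  rw [Measure.sum_apply _ hA]
  have : ∀ i, Measure.dirac (x i) A = ({i | x i ∈ A} : Set ι).indicator 1 i := by
    intro i
    rw [Measure.dirac_apply' _ hA]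
    by_cases hi : x i ∈ A <;> simp [hi]
  simp_rw [this]
  rw [← tsum_subtype]
  simp only [Pi.one_apply, ENNReal.tsum_one]
  rfl

/-- Embeddings with values in a set `A` are embeddings into the subtype of `A`. -/
def embeddingSubtypeEquiv {α β : Type*} (p : β → Prop) :
    {f : α ↪ β // ∀ a, p (f a)} ≃ (α ↪ {b // p b}) where
  toFun f := ⟨fun a => ⟨f.1 a, f.2 a⟩, fun _ _ h => f.1.injective (congrArg Subtype.val h)⟩
  invFun g := ⟨g.trans (Function.Embedding.subtype p), fun a => (g a).2⟩
  left_inv _ := rfl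
  right_inv _ := rfl

variable {S : Type*} [PseudoMetricSpace S] [MeasurableSpace S] [MeasurableSingletonClass S]

/-- Tuples of distinct indices with points in $B$ are embeddings of `Fin n` into the finite set of
indices in $B$, so correlation functions compute factorial moments. -/
theorem Conf.exists_apply_eq_natCast {ξ : Measure S} (h : ξ ∈ Conf S) {B : Set S}
    (hB : MeasurableSet B) (hb : Bornology.IsBounded B) :
    ∃ N : ℕ, ξ B = N ∧
      ∀ n, distinctTuples n ξ (Set.univ.pi fun _ => B) = (N.descFactorial n : ℕ) := by
  have h1 : ξ B = ENat.toENNReal (ENat.card {i : Points ξ // i.1 ∈ B}) := by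
    conv_lhs => rw [Conf.eq_sum_points h]
    rw [sum_dirac_apply _ hB]
  have hF : Finite {i : Points ξ // i.1 ∈ B} := by
    have h2 := h.2 B hb
    rw [h1] at h2
    by_contra hc
    rw [not_finite_iff_infinite] at hc
    simp [ENat.card_eq_top_of_infinite] at h2
  have := Fintype.ofFinite {i : Points ξ // i.1 ∈ B}
  refine ⟨Nat.card {i : Points ξ // i.1 ∈ B}, ?_, fun n => ?_⟩
  · rw [h1, ENat.card_eq_coe_natCard]
    simp
  · rw [distinctTuples, sum_dirac_apply _ (MeasurableSet.univ_pi fun _ => hB)]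
    have e : {i : Fin n ↪ Points ξ // (fun j => (i j).1) ∈ Set.univ.pi fun _ => B} ≃
        (Fin n ↪ {i : Points ξ // i.1 ∈ B}) :=
      (Equiv.subtypeEquivRight fun i => by simp).trans
        (embeddingSubtypeEquiv fun i : Points ξ => i.1 ∈ B)
    rw [ENat.card_congr e, ENat.card_eq_coe_natCard, Nat.card_eq_fintype_card,
      Fintype.card_embedding_eq, Nat.card_eq_fintype_card]
    simp

end Counting

/-! ### Mean and variance from the correlation functions -/

section Moments

variable {Ω S : Type*} [MeasurableSpace Ω] [PseudoMetricSpace S] [ProperSpace S]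
  [MeasurableSpace S]

theorem IsCorrelationFunction.integral_distinctTuples {P : Measure Ω} {Ξ : Ω → Measure S}
    {lam : Measure S} {n : ℕ} {ρ : (Fin n → S) → ℝ} (h : IsCorrelationFunction P Ξ lam n ρ)
    {B : Set S} (hB : MeasurableSet B) (hb : Bornology.IsBounded B) :
    Integrable (fun ω => (distinctTuples n (Ξ ω)).real (Set.univ.pi fun _ => B)) P ∧
      ∫ ω, (distinctTuples n (Ξ ω)).real (Set.univ.pi fun _ => B) ∂P =
        ∫ x in Set.univ.pi fun _ => B, ρ x ∂(Measure.pi fun _ : Fin n => lam) := by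
  set A : Set (Fin n → S) := Set.univ.pi fun _ => B with hA
  have mA : MeasurableSet A := MeasurableSet.univ_pi fun _ => hB
  set φ : (Fin n → S) → ℂ := A.indicator fun _ => 1 with hφ
  have mφ : Measurable φ := measurable_const.indicator mA
  have bφ : ∃ C : ℝ, ∀ x, ‖φ x‖ ≤ C := ⟨1, fun x => by
    by_cases hx : x ∈ A <;> simp [hφ, hx]⟩
  -- Properness makes the closure of the bounded set $B^n$ compact, so its indicator is an
  -- admissible test function.
  have cφ : HasCompactSupport φ := by
    refine HasCompactSupport.intro (K := closure A)
      (Bornology.IsBounded.pi fun _ => hb).isCompact_closure fun x hx => ?_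
    exact Set.indicator_of_notMem (fun hxA => hx (subset_closure hxA)) _
  have e : ∀ ω, ∫ x, φ x ∂(distinctTuples n (Ξ ω)) = (((distinctTuples n (Ξ ω)).real A : ℝ) : ℂ) := by
    intro ω
    rw [hφ, integral_indicator_const _ mA]
    simp
  have h1 := h.integrable φ mφ bφ cφ
  have h2 := h.integral_eq φ mφ bφ cφ
  simp_rw [e] at h1 h2
  refine ⟨by simpa using h1.re, ?_⟩
  have e2 : ∀ x, φ x * (ρ x : ℂ) = ((A.indicator ρ x : ℝ) : ℂ) := by
    intro x
    by_cases hx : x ∈ A <;> simp [hφ, hx]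
  simp_rw [e2] at h2
  rw [integral_complex_ofReal, integral_complex_ofReal, integral_indicator mA] at h2
  exact_mod_cast h2

variable [MeasurableSingletonClass S]

/-- The second factorial moment is that of $N(N-1)=N^2-N$; its integrability together with that of
$N$ gives square integrability. -/
theorem IsPointProcess.memLp_two_count {P : Measure Ω} [IsProbabilityMeasure P]
    {Ξ : Ω → Measure S} (hp : IsPointProcess P Ξ) {lam : Measure S}
    {ρ₁ : (Fin 1 → S) → ℝ} (h₁ : IsCorrelationFunction P Ξ lam 1 ρ₁)
    {ρ₂ : (Fin 2 → S) → ℝ} (h₂ : IsCorrelationFunction P Ξ lam 2 ρ₂)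
    {B : Set S} (hB : MeasurableSet B) (hb : Bornology.IsBounded B) :
    MemLp (fun ω => (Ξ ω B).toReal) 2 P ∧
    ∫ ω, (Ξ ω B).toReal ∂P =
      ∫ x in Set.univ.pi fun _ => B, ρ₁ x ∂(Measure.pi fun _ : Fin 1 => lam) ∧
    variance (fun ω => (Ξ ω B).toReal) P =
      (∫ x in Set.univ.pi fun _ => B, ρ₂ x ∂(Measure.pi fun _ : Fin 2 => lam)) +
      (∫ ω, (Ξ ω B).toReal ∂P) - (∫ ω, (Ξ ω B).toReal ∂P) ^ 2 := by
  obtain ⟨i1, e1⟩ := h₁.integral_distinctTuples hB hb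
  obtain ⟨i2, e2⟩ := h₂.integral_distinctTuples hB hb
  have a1 : (fun ω => (distinctTuples 1 (Ξ ω)).real (Set.univ.pi fun _ => B)) =ᵐ[P]
      fun ω => (Ξ ω B).toReal := by
    filter_upwards [hp.mem_conf] with ω hω
    obtain ⟨N, hN, hd⟩ := Conf.exists_apply_eq_natCast hω hB hb
    simp [Measure.real, hN, hd]
  have a2 : (fun ω => (distinctTuples 2 (Ξ ω)).real (Set.univ.pi fun _ => B)) =ᵐ[P]
      fun ω => (Ξ ω B).toReal ^ 2 - (Ξ ω B).toReal := by
    filter_upwards [hp.mem_conf] with ω hω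
    obtain ⟨N, hN, hd⟩ := Conf.exists_apply_eq_natCast hω hB hb
    rw [Measure.real, hd, hN, ENNReal.toReal_natCast, ENNReal.toReal_natCast,
      Nat.cast_descFactorial_two]
    ring
  have hm : Measurable fun ω => (Ξ ω B).toReal :=
    ((Measure.measurable_coe hB).comp hp.measurable).ennreal_toReal
  have j1 := i1.congr a1
  have j2 : Integrable (fun ω => (Ξ ω B).toReal ^ 2) P := by
    refine ((i2.congr a2).add j1).congr (Eventually.of_forall fun ω => ?_)
    simp
  have hL : MemLp (fun ω => (Ξ ω B).toReal) 2 P :=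
    (memLp_two_iff_integrable_sq hm.aestronglyMeasurable).2 j2
  refine ⟨hL, by rw [← e1, integral_congr_ae a1], ?_⟩
  rw [variance_eq_sub hL, ← e2, integral_congr_ae a2, integral_sub j2 j1]
  simp

end Moments

/-! ### Moments of the Heisenberg process -/

section HeisenbergMoments

theorem finrank_real_euclideanSpace_complex (D : ℕ) :
    Module.finrank ℝ (EuclideanSpace ℂ (Fin D)) = 2 * D := by
  rw [finrank_real_of_complex, finrank_euclideanSpace_fin]

theorem heisenbergKernel_self {D : ℕ} (x : EuclideanSpace ℂ (Fin D)) :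
    heisenbergKernel D x x = (Real.exp (‖x‖ ^ 2) : ℝ) := by
  rw [heisenbergKernel, EuclideanSpace.norm_sq_eq, Complex.ofReal_exp]
  congr 1
  push_cast
  exact Finset.sum_congr rfl fun l _ => by simpa using Complex.mul_conj' (x l)

/-- Polarization: $x\cdot\bar y+y\cdot\bar x=|x|^2+|y|^2-|x-y|^2$. -/
theorem heisenbergKernel_mul_swap {D : ℕ} (x y : EuclideanSpace ℂ (Fin D)) :
    heisenbergKernel D x y * heisenbergKernel D y x =
      (Real.exp (‖x‖ ^ 2 + ‖y‖ ^ 2 - ‖x - y‖ ^ 2) : ℝ) := by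
  rw [heisenbergKernel, heisenbergKernel, ← Complex.exp_add, Complex.ofReal_exp,
    EuclideanSpace.norm_sq_eq, EuclideanSpace.norm_sq_eq, EuclideanSpace.norm_sq_eq,
    ← Finset.sum_add_distrib, ← Finset.sum_add_distrib, ← Finset.sum_sub_distrib]
  congr 1
  push_cast
  refine Finset.sum_congr rfl fun l _ => ?_
  rw [← Complex.mul_conj', ← Complex.mul_conj', ← Complex.mul_conj', PiLp.sub_apply, map_sub]
  ring

variable {D : ℕ}

theorem integral_gaussianReference_restrict {B : Set (EuclideanSpace ℂ (Fin D))}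
    (hB : MeasurableSet B) (f : EuclideanSpace ℂ (Fin D) → ℝ) :
    ∫ x in B, f x ∂(gaussianReference D) =
      ∫ x in B, Real.exp (-‖x‖ ^ 2) / Real.pi ^ D * f x := by
  rw [gaussianReference, setIntegral_withDensity_eq_setIntegral_toReal_smul₀ (by fun_prop)
    (by simp) _ hB]
  refine integral_congr_ae (Eventually.of_forall fun x => ?_)
  beta_reduce
  rw [ENNReal.toReal_ofReal (by positivity), smul_eq_mul]

theorem isFiniteMeasure_gaussianReference (hD : D ≠ 0) :
    IsFiniteMeasure (gaussianReference D) := by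
  refine isFiniteMeasure_withDensity_ofReal (Integrable.hasFiniteIntegral ?_)
  have := integrable_exp_neg_norm_sq_mul_norm_pow hD (finrank_real_euclideanSpace_complex D) 0
  simpa using this.div_const (Real.pi ^ D)

theorem integral_exp_norm_sq_gaussianReference {B : Set (EuclideanSpace ℂ (Fin D))}
    (hB : MeasurableSet B) :
    ∫ x in B, Real.exp (‖x‖ ^ 2) ∂(gaussianReference D) = volume.real B / Real.pi ^ D := by
  rw [integral_gaussianReference_restrict hB]
  have : ∀ x : EuclideanSpace ℂ (Fin D),
      Real.exp (-‖x‖ ^ 2) / Real.pi ^ D * Real.exp (‖x‖ ^ 2) = (Real.pi ^ D)⁻¹ := by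
    intro x
    rw [div_mul_eq_mul_div, ← Real.exp_add, neg_add_cancel, Real.exp_zero, one_div]
  simp_rw [this]
  rw [setIntegral_const, smul_eq_mul, div_eq_mul_inv]

theorem integral_integral_kernel_sq_gaussianReference {B : Set (EuclideanSpace ℂ (Fin D))}
    (hB : MeasurableSet B) :
    ∫ x in B, ∫ y in B, Real.exp (‖x‖ ^ 2 + ‖y‖ ^ 2 - ‖x - y‖ ^ 2)
        ∂(gaussianReference D) ∂(gaussianReference D) =
      (∫ x in B, ∫ y in B, Real.exp (-‖x - y‖ ^ 2)) / Real.pi ^ (2 * D) := by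
  simp_rw [integral_gaussianReference_restrict hB, ← integral_const_mul]
  rw [← integral_div]
  refine integral_congr_ae (Eventually.of_forall fun x => ?_)
  beta_reduce
  rw [← integral_div]
  refine integral_congr_ae (Eventually.of_forall fun y => ?_)
  beta_reduce
  have : Real.exp (-‖x - y‖ ^ 2) =
      Real.exp (-‖x‖ ^ 2) * Real.exp (-‖y‖ ^ 2) *
        Real.exp (‖x‖ ^ 2 + ‖y‖ ^ 2 - ‖x - y‖ ^ 2) := by
    rw [← Real.exp_add, ← Real.exp_add]
    congr 1
    ring
  rw [this, two_mul, pow_add]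
  field_simp

variable {Ω : Type*} [MeasurableSpace Ω] {P : Measure Ω} [IsProbabilityMeasure P]
  {Ξ : Ω → Measure (EuclideanSpace ℂ (Fin D))}

theorem IsHeisenbergDPP.moments (hD : D ≠ 0) (hΞ : IsHeisenbergDPP P D Ξ) (R : ℝ) :
    MemLp (ballCount Ξ R) 2 P ∧
    ballMean P Ξ R =
      volume.real (Metric.ball (0 : EuclideanSpace ℂ (Fin D)) R) / Real.pi ^ D ∧
    ballVariance P Ξ R = ballMean P Ξ R -
      (∫ x in Metric.ball (0 : EuclideanSpace ℂ (Fin D)) R,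
        ∫ y in Metric.ball (0 : EuclideanSpace ℂ (Fin D)) R, Real.exp (-‖x - y‖ ^ 2)) /
          Real.pi ^ (2 * D) := by
  obtain ⟨ρ₁, h₁, hd₁⟩ := hΞ.correlation 1 le_rfl
  obtain ⟨ρ₂, h₂, hd₂⟩ := hΞ.correlation 2 one_le_two
  have := isFiniteMeasure_gaussianReference hD
  set B := Metric.ball (0 : EuclideanSpace ℂ (Fin D)) R with hBdef
  have hB : MeasurableSet B := measurableSet_ball
  obtain ⟨hL, hm, hv⟩ := hΞ.isPointProcess.memLp_two_count h₁ h₂ hB Metric.isBounded_ball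
  have r₁ : ∀ x, ρ₁ x = Real.exp (‖x 0‖ ^ 2) := by
    intro x
    have := hd₁ x
    rw [Matrix.det_fin_one, Matrix.of_apply, heisenbergKernel_self] at this
    exact_mod_cast this
  have r₂ : ∀ x, ρ₂ x = Real.exp (‖x 0‖ ^ 2) * Real.exp (‖x 1‖ ^ 2) -
      Real.exp (‖x 0‖ ^ 2 + ‖x 1‖ ^ 2 - ‖x 0 - x 1‖ ^ 2) := by
    intro x
    have := hd₂ x
    rw [Matrix.det_fin_two] at this
    simp only [Matrix.of_apply] at this
    rw [heisenbergKernel_mul_swap, heisenbergKernel_self, heisenbergKernel_self] at this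
    exact_mod_cast this
  have m₁ : ∫ x in Set.univ.pi fun _ => B, ρ₁ x ∂(Measure.pi fun _ : Fin 1 => gaussianReference D) =
      ∫ x in B, Real.exp (‖x‖ ^ 2) ∂(gaussianReference D) := by
    rw [← (measurePreserving_funUnique (gaussianReference D) (Fin 1)).setIntegral_preimage_emb
      (MeasurableEquiv.measurableEmbedding _)]
    simp_rw [r₁]
    have : (MeasurableEquiv.funUnique (Fin 1) (EuclideanSpace ℂ (Fin D))) ⁻¹' B =
        Set.univ.pi fun _ => B := by
      ext x
      simp [MeasurableEquiv.funUnique]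
    rw [this]
    rfl
  have hbdd : ∀ x ∈ B, ‖x‖ ^ 2 ≤ R ^ 2 := fun x hx => by
    have : ‖x‖ < R := by simpa [hBdef] using hx
    exact pow_le_pow_left₀ (norm_nonneg x) this.le 2
  have i₁ : IntegrableOn (fun x => Real.exp (‖x‖ ^ 2)) B (gaussianReference D) := by
    refine Measure.integrableOn_of_bounded (M := Real.exp (R ^ 2)) (measure_ne_top _ _)
      (by fun_prop : Continuous fun x : EuclideanSpace ℂ (Fin D) =>
        Real.exp (‖x‖ ^ 2)).aestronglyMeasurable ?_
    filter_upwards [ae_restrict_mem hB] with x hx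
    rw [Real.norm_eq_abs, Real.abs_exp, Real.exp_le_exp]
    exact hbdd x hx
  have i₂ : IntegrableOn (fun p : EuclideanSpace ℂ (Fin D) × EuclideanSpace ℂ (Fin D) =>
      Real.exp (‖p.1‖ ^ 2) * Real.exp (‖p.2‖ ^ 2)) (B ×ˢ B)
      ((gaussianReference D).prod (gaussianReference D)) := by
    rw [IntegrableOn, ← Measure.prod_restrict]
    exact i₁.mul_prod i₁
  -- The off-diagonal product is dominated by the diagonal one because $e^{-|x-y|^2}\le1$.
  have i₃ : IntegrableOn (fun p : EuclideanSpace ℂ (Fin D) × EuclideanSpace ℂ (Fin D) =>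
      Real.exp (‖p.1‖ ^ 2 + ‖p.2‖ ^ 2 - ‖p.1 - p.2‖ ^ 2)) (B ×ˢ B)
      ((gaussianReference D).prod (gaussianReference D)) := by
    refine i₂.mono' (by fun_prop : Continuous fun p : EuclideanSpace ℂ (Fin D) ×
      EuclideanSpace ℂ (Fin D) => Real.exp (‖p.1‖ ^ 2 + ‖p.2‖ ^ 2 -
        ‖p.1 - p.2‖ ^ 2)).aestronglyMeasurable (Eventually.of_forall fun p => ?_)
    rw [Real.norm_eq_abs, Real.abs_exp, ← Real.exp_add, Real.exp_le_exp]
    linarith [sq_nonneg ‖p.1 - p.2‖]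
  have m₂ : ∫ x in Set.univ.pi fun _ => B, ρ₂ x ∂(Measure.pi fun _ : Fin 2 => gaussianReference D) =
      (∫ x in B, Real.exp (‖x‖ ^ 2) ∂(gaussianReference D)) ^ 2 -
      ∫ x in B, ∫ y in B, Real.exp (‖x‖ ^ 2 + ‖y‖ ^ 2 - ‖x - y‖ ^ 2)
        ∂(gaussianReference D) ∂(gaussianReference D) := by
    rw [← setIntegral_prod _ i₃, sq, ← setIntegral_prod_mul, ← integral_sub i₂ i₃,
      ← (measurePreserving_finTwoArrow (gaussianReference D)).setIntegral_preimage_emb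
      (MeasurableEquiv.measurableEmbedding _)]
    simp_rw [r₂]
    have : (MeasurableEquiv.finTwoArrow (α := EuclideanSpace ℂ (Fin D))) ⁻¹' (B ×ˢ B) =
        Set.univ.pi fun _ => B := by
      ext x
      simp [MeasurableEquiv.finTwoArrow, Fin.forall_fin_two]
    rw [this]
    rfl
  have hmean : ballMean P Ξ R = ∫ x in B, Real.exp (‖x‖ ^ 2) ∂(gaussianReference D) := by
    rw [← m₁, ← hm]
    rfl
  refine ⟨hL, by rw [hmean, integral_exp_norm_sq_gaussianReference hB], ?_⟩
  change variance (fun ω => (Ξ ω B).toReal) P = _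
  rw [hv, m₂, ← integral_integral_kernel_sq_gaussianReference hB, hm, m₁, hmean]
  ring

theorem IsHeisenbergDPP.ballMean_eq (hD : D ≠ 0) (hΞ : IsHeisenbergDPP P D Ξ) {R : ℝ}
    (hR : 0 ≤ R) : ballMean P Ξ R = R ^ (2 * D) / D.factorial := by
  rw [(hΞ.moments hD R).2.1, volume_real_ball hD (finrank_real_euclideanSpace_complex D) hR]
  field_simp

theorem IsHeisenbergDPP.ballVariance_eq (hD : D ≠ 0) (hΞ : IsHeisenbergDPP P D Ξ) {R : ℝ}
    (hR : 0 ≤ R) : ballVariance P Ξ R =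
      unitBallVolume (2 * D - 1) / Real.pi ^ (2 * D) *
        ∫ h : EuclideanSpace ℂ (Fin D), Real.exp (-‖h‖ ^ 2) *
          ∫ t in (-(‖h‖ / 2))..(‖h‖ / 2), √(R ^ 2 - t ^ 2) ^ (2 * D - 1) := by
  obtain ⟨-, hm, hv⟩ := hΞ.moments hD R
  have hE := finrank_real_euclideanSpace_complex D
  have h := integral_ball_gaussian_escape hD hE R
  simp_rw [volume_real_ball_diff_translate (E := EuclideanSpace ℂ (Fin D)) (n := 2 * D - 1)
    (by omega) (by omega) R hR] at h
  have e : ∫ h : EuclideanSpace ℂ (Fin D), Real.exp (-‖h‖ ^ 2) * (unitBallVolume (2 * D - 1) *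
        ∫ t in (-(‖h‖ / 2))..(‖h‖ / 2), √(R ^ 2 - t ^ 2) ^ (2 * D - 1)) =
      unitBallVolume (2 * D - 1) * ∫ h : EuclideanSpace ℂ (Fin D), Real.exp (-‖h‖ ^ 2) *
        ∫ t in (-(‖h‖ / 2))..(‖h‖ / 2), √(R ^ 2 - t ^ 2) ^ (2 * D - 1) := by
    rw [← integral_const_mul]
    refine integral_congr_ae (Eventually.of_forall fun h => ?_)
    beta_reduce
    ring
  rw [hv, hm, div_mul_eq_mul_div, ← e, ← h, two_mul, pow_add]
  field_simp

end HeisenbergMoments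

/-! ### Identification of the coefficients -/

section Coefficients

theorem alphaCoeff_succ (k D : ℕ) :
    alphaCoeff (k + 1) D = alphaCoeff k D * (4 * (D : ℝ) ^ 2 - (2 * (k : ℝ) + 1) ^ 2) := by
  rw [alphaCoeff, Finset.prod_Icc_succ_top (by omega), alphaCoeff]
  push_cast
  ring

theorem alphaCoeff_eq_prod_Icc_int (k D : ℕ) :
    alphaCoeff k D =
      ∏ l ∈ Finset.Icc (-(k : ℤ) + 1) (k : ℤ), (2 * (D : ℝ) + 2 * (l : ℝ) - 1) := by
  induction k with
  | zero => simp [alphaCoeff]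
  | succ k ih =>
    -- The two new indices $k+1$ and $-k$ contribute $(2D+2k+1)(2D-2k-1)=4D^2-(2k+1)^2$.
    have h : Finset.Icc (-((k + 1 : ℕ) : ℤ) + 1) ((k + 1 : ℕ) : ℤ) =
        insert ((k : ℤ) + 1) (insert (-(k : ℤ)) (Finset.Icc (-(k : ℤ) + 1) (k : ℤ))) := by
      ext l
      simp only [Finset.mem_Icc, Finset.mem_insert]
      omega
    rw [h, Finset.prod_insert (by simp only [Finset.mem_Icc, Finset.mem_insert]; omega),
      Finset.prod_insert (by simp only [Finset.mem_Icc]; omega), ← ih, alphaCoeff_succ]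
    push_cast
    ring

theorem Ring.choose_succ_mul_succ (a : ℝ) (k : ℕ) :
    Ring.choose a (k + 1) * (k + 1) = Ring.choose a k * (a - k) := by
  rw [Ring.choose_eq_smul, Ring.choose_eq_smul, descPochhammer_succ_right, Polynomial.smeval_mul,
    Nat.factorial_succ]
  have : ((k.factorial : ℕ) : ℝ) ≠ 0 := by positivity
  simp only [smul_eq_mul, Polynomial.smeval_sub, Polynomial.smeval_X, pow_one,
    Polynomial.smeval_natCast, pow_zero]
  push_cast
  field_simp
  simp

/-- From $k$ to $k+1$ the binomial and factorial contribute $D-\frac12-k$, and Gamma contributes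
$D+k+\frac12$; four times their product is $4D^2-(2k+1)^2$, the new factor of $\alpha_{k+1}$. -/
theorem choose_mul_Gamma_eq_alphaCoeff {D : ℕ} (hD : D ≠ 0) (k : ℕ) :
    Ring.choose ((D : ℝ) - 1 / 2) k * Real.Gamma (D + k + 1 / 2) * k.factorial * 4 ^ k =
      alphaCoeff k D * Real.Gamma (D + 1 / 2) := by
  induction k with
  | zero => simp [alphaCoeff]
  | succ k ih =>
    have hG : Real.Gamma (D + ((k + 1 : ℕ) : ℝ) + 1 / 2) =
        (D + k + 1 / 2) * Real.Gamma (D + k + 1 / 2) := by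
      rw [← Real.Gamma_add_one (by positivity)]
      congr 1
      push_cast
      ring
    have hc := Ring.choose_succ_mul_succ ((D : ℝ) - 1 / 2) k
    rw [hG, alphaCoeff_succ, mul_right_comm (alphaCoeff k D), ← ih, Nat.factorial_succ]
    push_cast
    calc _ = (Ring.choose ((D : ℝ) - 1 / 2) (k + 1) * (k + 1)) *
          ((D + k + 1 / 2) * Real.Gamma (D + k + 1 / 2)) * k.factorial * 4 ^ (k + 1) := by ring
      _ = _ := by
        rw [hc]
        ring

/-- The Gamma value $\Gamma(D+\frac12)$ in the volume of the unit $(2D-1)$-ball cancels the one from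
the recurrence. The odd power of $\sqrt\pi$ leaves $1/\sqrt\pi$, and $4^k\cdot2^{2k}=2^{4k}$. -/
theorem expansion_coefficient_eq {D : ℕ} (hD : D ≠ 0) (k : ℕ) :
    unitBallVolume (2 * D - 1) / Real.pi ^ (2 * D) * D.factorial *
      (halfPowerCoeff (2 * D - 1) k * (D * (Real.pi ^ D / D.factorial) *
        Real.Gamma (D + k + 1 / 2) / ((2 * k + 1) * 2 ^ (2 * k)))) =
    D / √Real.pi * ((-1) ^ k *
      (alphaCoeff k D / ((2 * (k : ℝ) + 1) * (k.factorial : ℝ) * 2 ^ (4 * k)))) := by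
  have hn : ((2 * D - 1 : ℕ) : ℝ) / 2 = D - 1 / 2 := by
    rw [Nat.cast_sub (by omega)]
    push_cast
    ring
  have hs : √Real.pi ^ (2 * D - 1) = Real.pi ^ D / √Real.pi := by
    rw [eq_div_iff (by positivity), ← pow_succ, show 2 * D - 1 + 1 = 2 * D by omega, pow_mul,
      Real.sq_sqrt Real.pi_pos.le]
  have hG : (D : ℝ) - 1 / 2 + 1 = D + 1 / 2 := by ring
  have hG0 : Real.Gamma (D + 1 / 2) ≠ 0 := (Real.Gamma_pos_of_pos (by positivity)).ne'
  have key := choose_mul_Gamma_eq_alphaCoeff hD k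
  have hα : alphaCoeff k D = Ring.choose ((D : ℝ) - 1 / 2) k * Real.Gamma (D + k + 1 / 2) *
      k.factorial * 4 ^ k / Real.Gamma (D + 1 / 2) := by
    rw [eq_div_iff hG0, key]
  have h4 : (2 : ℝ) ^ (4 * k) = 4 ^ k * 2 ^ (2 * k) := by
    rw [show 4 * k = 2 * k + 2 * k by ring, pow_add, pow_mul]
    norm_num
  have hf : (k.factorial : ℝ) ≠ 0 := by positivity
  rw [unitBallVolume, halfPowerCoeff, hn, hs, hG, hα, h4, two_mul D, pow_add]
  field_simp

end Coefficients

/-! ### The asymptotic expansion and its consequences -/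

section Expansion

variable {D : ℕ} {Ω : Type*} [MeasurableSpace Ω] {P : Measure Ω} [IsProbabilityMeasure P]
  {Ξ : Ω → Measure (EuclideanSpace ℂ (Fin D))}

theorem IsHeisenbergDPP.variance_div_mean_isBigO (hD : D ≠ 0) (hΞ : IsHeisenbergDPP P D Ξ)
    (N : ℕ) :
    (fun R : ℝ => ballVariance P Ξ R / ballMean P Ξ R -
        (D : ℝ) / √Real.pi * R⁻¹ *
          ∑ k ∈ Finset.range N,
            (-1 : ℝ) ^ k * (alphaCoeff k D / ((2 * (k : ℝ) + 1) * (k.factorial : ℝ) * 2 ^ (4 * k))) *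
              (R⁻¹) ^ (2 * k))
        =O[atTop] fun R : ℝ => (R⁻¹) ^ (2 * N + 1) := by
  obtain ⟨C, hC⟩ := exists_integral_exp_mul_slab_remainder_le hD
    (finrank_real_euclideanSpace_complex D) (2 * D - 1) N
  -- The prefactor of the variance, times the $D!$ obtained on dividing by the mean $R^{2D}/D!$.
  set c : ℝ := unitBallVolume (2 * D - 1) / Real.pi ^ (2 * D) * D.factorial with hc
  have hc0 : 0 ≤ c := by
    have := (unitBallVolume_pos (2 * D - 1)).le
    positivity
  refine IsBigO.of_bound (c * C) ?_
  filter_upwards [eventually_gt_atTop 0] with R hR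
  have hRn : R ^ (2 * D - 1) * (R⁻¹) ^ (2 * D) = R⁻¹ := by
    have h2 : 2 * D = 2 * D - 1 + 1 := by omega
    rw [inv_pow]
    nth_rewrite 2 [h2]
    rw [pow_succ]
    field_simp
  rw [hΞ.ballVariance_eq hD hR.le, hΞ.ballMean_eq hD hR.le]
  have h₀ := hC R hR
  set I := ∫ h : EuclideanSpace ℂ (Fin D), Real.exp (-‖h‖ ^ 2) *
    ∫ t in (-(‖h‖ / 2))..(‖h‖ / 2), √(R ^ 2 - t ^ 2) ^ (2 * D - 1)
  have h := mul_le_mul_of_nonneg_left h₀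
    (mul_nonneg hc0 (pow_nonneg (inv_nonneg.2 hR.le) (2 * D)))
  have habs := abs_of_nonneg (mul_nonneg hc0 (pow_nonneg (inv_nonneg.2 hR.le) (2 * D)))
  rw [← habs, ← abs_mul, habs] at h
  refine le_trans (le_of_eq ?_) (h.trans (le_of_eq ?_))
  · rw [Real.norm_eq_abs]
    congr 1
    rw [mul_sub, Finset.mul_sum, Finset.mul_sum]
    congr 1
    · rw [hc, inv_pow]
      field_simp
    · refine Finset.sum_congr rfl fun k _ => ?_
      calc _ = D / √Real.pi * ((-1) ^ k *
            (alphaCoeff k D / ((2 * (k : ℝ) + 1) * (k.factorial : ℝ) * 2 ^ (4 * k)))) *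
              (R ^ (2 * D - 1) * (R⁻¹) ^ (2 * D)) * (R⁻¹) ^ (2 * k) := by
            rw [hRn]
            ring
        _ = _ := by
          rw [← expansion_coefficient_eq hD, ← hc]
          ring
  · rw [Real.norm_eq_abs, abs_of_nonneg (pow_nonneg (inv_nonneg.2 hR.le) _), pow_succ (R⁻¹) (2 * N)]
    calc _ = c * C * (R⁻¹) ^ (2 * N) * (R ^ (2 * D - 1) * (R⁻¹) ^ (2 * D)) := by ring
      _ = _ := by
        rw [hRn]
        ring

theorem IsHeisenbergDPP.tendsto_mul_variance_div_mean (hD : D ≠ 0) (hΞ : IsHeisenbergDPP P D Ξ) :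
    Tendsto (fun R : ℝ => R * (ballVariance P Ξ R / ballMean P Ξ R)) atTop
      (𝓝 ((D : ℝ) / √Real.pi)) := by
  -- With one term kept the remainder is $O(R^{-3})$, which still vanishes after multiplication by
  -- $R$.
  have h := (isBigO_refl (fun R : ℝ => R) atTop).mul (hΞ.variance_div_mean_isBigO hD 1)
  have h0 : Tendsto (fun R : ℝ => R * (R⁻¹) ^ (2 * 1 + 1)) atTop (𝓝 0) := by
    have h1 : Tendsto (fun R : ℝ => (R⁻¹) ^ 2) atTop (𝓝 0) := by
      simpa using (tendsto_inv_atTop_zero (𝕜 := ℝ)).pow 2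
    refine h1.congr' ?_
    filter_upwards [eventually_gt_atTop 0] with R hR
    rw [show (2 * 1 + 1 : ℕ) = 2 + 1 from rfl, pow_succ' R⁻¹ 2, mul_inv_cancel_left₀ hR.ne']
  have h2 := (h.trans_tendsto h0).add_const ((D : ℝ) / √Real.pi)
  rw [zero_add] at h2
  refine h2.congr' ?_
  filter_upwards [eventually_gt_atTop 0] with R hR
  simp only [Finset.range_one, Finset.sum_singleton, pow_zero, alphaCoeff, Nat.factorial_zero,
    mul_zero, Nat.cast_zero, Nat.cast_one, zero_add, mul_one, div_one, zero_lt_one,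
    Finset.Icc_eq_empty_of_lt, Finset.prod_empty]
  field_simp
  ring

theorem IsHeisenbergDPP.isHyperuniformClassI (hD : D ≠ 0) (hΞ : IsHeisenbergDPP P D Ξ) :
    IsHyperuniformClassI P Ξ (2 * D) := by
  have h := hΞ.tendsto_mul_variance_div_mean hD
  refine ⟨?_, ?_⟩
  · have h0 := h.mul (tendsto_inv_atTop_zero (𝕜 := ℝ))
    rw [mul_zero] at h0
    refine h0.congr' ?_
    filter_upwards [eventually_gt_atTop 0] with R hR
    field_simp
  · have hD' : (0 : ℝ) < D := by exact_mod_cast Nat.pos_of_ne_zero hD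
    set L : ℝ := (D : ℝ) / √Real.pi with hL
    have hL0 : 0 < L := by positivity
    -- The variance is $R^{2D-1}/D!$ times a quantity tending to $L$, hence eventually between $L/2$
    -- and $2L$.
    refine ⟨L / 2 / D.factorial, 2 * L / D.factorial, by positivity, by positivity, ?_⟩
    filter_upwards [eventually_gt_atTop 0, h.eventually_const_lt (half_lt_self hL0),
      h.eventually_lt_const (show L < 2 * L by linarith)] with R hR h1 h2
    have e : ballVariance P Ξ R = R * (ballVariance P Ξ R / ballMean P Ξ R) / D.factorial *
        R ^ (2 * D - 1) := by
      have h3 : R ^ (2 * D) = R ^ (2 * D - 1) * R := by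
        rw [← pow_succ]
        congr 1
        omega
      rw [hΞ.ballMean_eq hD hR.le, h3]
      field_simp
    have hp : 0 < R ^ (2 * D - 1) := by positivity
    rw [e]
    exact ⟨by gcongr, by gcongr⟩

end Expansion

theorem theorem1p2 {Ω : Type*} [MeasurableSpace Ω] (P : Measure Ω) [IsProbabilityMeasure P]
    (D : ℕ) (hD : 1 ≤ D) (Ξ : Ω → Measure (EuclideanSpace ℂ (Fin D)))
    (hΞ : IsHeisenbergDPP P D Ξ) :
    (∀ R : ℝ, MemLp (ballCount Ξ R) 2 P) ∧
    IsHyperuniformClassI P Ξ (2 * D) ∧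
    Tendsto (fun R : ℝ => R * (ballVariance P Ξ R / ballMean P Ξ R)) atTop
      (𝓝 ((D : ℝ) / √Real.pi)) ∧
    (∀ N : ℕ,
      (fun R : ℝ => ballVariance P Ξ R / ballMean P Ξ R -
        (D : ℝ) / √Real.pi * R⁻¹ *
          ∑ k ∈ Finset.range N,
            (-1 : ℝ) ^ k * (alphaCoeff k D / ((2 * (k : ℝ) + 1) * (k.factorial : ℝ) * 2 ^ (4 * k))) *
              (R⁻¹) ^ (2 * k))
        =O[atTop] fun R : ℝ => (R⁻¹) ^ (2 * N + 1)) ∧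
    (∀ k : ℕ, alphaCoeff k D =
      ∏ l ∈ Finset.Icc (-(k : ℤ) + 1) (k : ℤ), (2 * (D : ℝ) + 2 * (l : ℝ) - 1)) := by
  have hD0 : D ≠ 0 := by omega
  exact ⟨fun R => (hΞ.moments hD0 R).1, hΞ.isHyperuniformClassI hD0,
    hΞ.tendsto_mul_variance_div_mean hD0, fun N => hΞ.variance_div_mean_isBigO hD0 N,
    fun k => alphaCoeff_eq_prod_Icc_int k D⟩
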